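/- Let $X$ be a non-empty finite set with $n$ elements, and let $S:X\times X\to X\times X$, $S(x,y)=(g_x(y),f_y(x))$, be a non-degenerate symmetric set-theoretical solution of the quantum Yang–Baxter equation. That is, all the maps $g_x,f_x:X\to X$ are bijective, $S\circ S=\mathrm{Id}$, and $S^{12}S^{23}S^{12}=S^{23}S^{12}S^{23}$ on $X^3$. A pair $(x,y)\in X^2$ is called frozen if $S(x,y)=(x,y)$. Assume Property $(\mathcal C)$: for every frozen pair $(x,y)$ one has $g_x\circ g_y=\mathrm{Id}_X$ and $f_y\circ f_x=\mathrm{Id}_X$. Let $M(X,S)$ and $G(X,S)$ be the monoid and the group with presentation $\langle X\mid xy=g_x(y)f_y(x)\ ;\ x,y\in X,\ S(x,y)\neq(x,y)\rangle$. A Garside element of $M(X,S)$ is an element whose left divisors and right divisors are the same elements and whose divisors generate $M(X,S)$. The monoid $M(X,S)$ has a unique Garside element $\Delta$ that both left-divides and right-divides every Garside element; it is called the Garside element of $M(X,S)$. Let $V$ be the real vector space with basis $X$, and for $x\in X$ put $\phi_x=f_x^{-1}$. Let $\psi_x\in GL(V)$ be the linear map with $\psi_x(x)=-\phi_x(x)$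 and $\psi_x(y)=\phi_x(y)$ for $y\in X\setminus\{x\}$. The assignment $x\mapsto\psi_x$ extends to a morphism $\psi:G(X,S)\to GL(V)$; let $W(X,S)=\psi(G(X,S))$ be its image, and set $\mathbf X=\{\psi_x\mid x\in X\}$. Composing $\psi$ with the canonical morphism $M(X,S)\to G(X,S)$, we also write $\psi(a)$ for $a\in M(X,S)$. The length on $\mathbf X$ of $w\in W(X,S)$ is the least length of a word on $\mathbf X$ that represents $w$. Then: (1) The group $W(X,S)$ contains a unique element $w_0$ of maximal length on $\mathbf X$. This element is $\psi(\Delta)$, and its length on $\mathbf X$ is $n$. (2) The order of $w_0$ is two, and conjugation by $w_0$ permutes the elements of $\mathbf X$. -/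

import Mathlib

noncomputable section

/-- A non-degenerate symmetric (that is, involutive and braided) set-theoretical solution
`(X, S)` of the quantum Yang-Baxter equation. We write `S (x, y) = (g_x y, f_y x)`. -/
structure SymmSolution (X : Type*) where
  /-- the map `S : X × X → X × X` -/
  S : X × X → X × X
  /-- every `g_x : y ↦ (S (x, y)).1` is bijective -/
  bijective_g : ∀ x, Function.Bijective fun y => (S (x, y)).1
  /-- every `f_y : x ↦ (S (x, y)).2` is bijective -/
  bijective_f : ∀ y, Function.Bijective fun x => (S (x, y)).2
  /-- `S ∘ S = id` -/
  involutive : ∀ p, S (S p) = p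
  /-- `S¹² S²³ S¹² = S²³ S¹² S²³` as maps of `X × X × X` -/
  braided :
    let S12 : X × X × X → X × X × X := fun t =>
      ((S (t.1, t.2.1)).1, (S (t.1, t.2.1)).2, t.2.2)
    let S23 : X × X × X → X × X × X := fun t => (t.1, S t.2)
    S12 ∘ S23 ∘ S12 = S23 ∘ S12 ∘ S23

namespace SymmSolution

variable {X : Type*} (s : SymmSolution X)

/-- The map `g_x : X → X`. -/
def g (x y : X) : X := (s.S (x, y)).1

/-- The map `f_y : X → X`; note the order of the arguments, `s.f y x = f_y(x)`. -/
def f (y x : X) : X := (s.S (x, y)).2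

/-- `(x, y)` is a frozen pair if `S (x, y) = (x, y)`. -/
def IsFrozen (x y : X) : Prop := s.S (x, y) = (x, y)

/-- Property (C): `g_x ∘ g_y = id` and `f_y ∘ f_x = id` for every frozen pair `(x, y)`. -/
def PropertyC : Prop :=
  ∀ x y, s.IsFrozen x y → s.g x ∘ s.g y = id ∧ s.f y ∘ s.f x = id

/-- The defining relations `x y = g_x(y) f_y(x)`, for `S (x, y) ≠ (x, y)`, as pairs of words. -/
def monoidRel (u v : FreeMonoid X) : Prop :=
  ∃ x y, ¬ s.IsFrozen x y ∧ u = FreeMonoid.of x * FreeMonoid.of y ∧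
    v = FreeMonoid.of (s.g x y) * FreeMonoid.of (s.f y x)

/-- The structure monoid `M(X, S)`, given by its monoid presentation. -/
abbrev StructureMonoid : Type _ := PresentedMonoid s.monoidRel

/-- The defining relators of the structure group. -/
def groupRels : Set (FreeGroup X) :=
  {r | ∃ x y, ¬ s.IsFrozen x y ∧
    r = FreeGroup.of x * FreeGroup.of y *
      (FreeGroup.of (s.g x y) * FreeGroup.of (s.f y x))⁻¹}

/-- The structure group `G(X, S)`, given by the group presentation on the same generators and
relations. -/
abbrev StructureGroup : Type _ := PresentedGroup s.groupRels

/-- The canonical morphism `M(X, S) → G(X, S)`, the identity on the generators. -/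
def toGroup : s.StructureMonoid →* s.StructureGroup :=
  PresentedMonoid.lift (fun x => PresentedGroup.of x) (by
    rintro u v ⟨x, y, h, rfl, rfl⟩
    simp only [map_mul, FreeMonoid.lift_eval_of]
    refine mul_inv_eq_one.mp ?_
    exact PresentedGroup.one_of_mem (rels := s.groupRels) ⟨x, y, h, rfl⟩)

/-- The permutation `φ_x = f_x⁻¹` of `X`. -/
def phi (x : X) : Equiv.Perm X := (Equiv.ofBijective (s.f x) (s.bijective_f x)).symm

lemma f_phi (x y : X) : s.f x (s.phi x y) = y :=
  (Equiv.ofBijective (s.f x) (s.bijective_f x)).apply_symm_apply y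

lemma phi_f (x y : X) : s.phi x (s.f x y) = y :=
  (Equiv.ofBijective (s.f x) (s.bijective_f x)).symm_apply_apply y

open Classical in
/-- The linear map `ψ_x` of the real vector space `V` with basis `X`: `ψ_x(y) = φ_x(y)` for
`y ≠ x`, and `ψ_x(x) = -φ_x(x)`. -/
def psiLin (x : X) : (X →₀ ℝ) →ₗ[ℝ] (X →₀ ℝ) :=
  Finsupp.linearCombination ℝ fun y =>
    if y = x then -Finsupp.single (s.phi x y) 1 else Finsupp.single (s.phi x y) 1

open Classical in
/-- The inverse of `ψ_x`. -/
def psiLinInv (x : X) : (X →₀ ℝ) →ₗ[ℝ] (X →₀ ℝ) :=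
  Finsupp.linearCombination ℝ fun y =>
    if s.f x y = x then -Finsupp.single (s.f x y) 1 else Finsupp.single (s.f x y) 1

open Classical in
lemma psiLin_single (x y : X) : s.psiLin x (Finsupp.single y 1) =
    if y = x then -Finsupp.single (s.phi x y) 1 else Finsupp.single (s.phi x y) 1 := by
  simp [psiLin]

open Classical in
lemma psiLinInv_single (x y : X) : s.psiLinInv x (Finsupp.single y 1) =
    if s.f x y = x then -Finsupp.single (s.f x y) 1 else Finsupp.single (s.f x y) 1 := by
  simp [psiLinInv]

/-- `ψ_x` as an element of `GL(V)`. -/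
def psiGen (x : X) : LinearMap.GeneralLinearGroup ℝ (X →₀ ℝ) where
  val := s.psiLin x
  inv := s.psiLinInv x
  val_inv := by
    ext1 y
    ext1
    simp only [LinearMap.comp_apply, Finsupp.lsingle_apply, Module.End.mul_apply,
      Module.End.one_apply, psiLinInv_single]
    split_ifs with h
    · rw [map_neg, psiLin_single, if_pos h, phi_f, neg_neg]
    · rw [psiLin_single, if_neg h, phi_f]
  inv_val := by
    ext1 y
    ext1
    simp only [LinearMap.comp_apply, Finsupp.lsingle_apply, Module.End.mul_apply,
      Module.End.one_apply, psiLin_single]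
    split_ifs with h <;> simp [psiLinInv_single, f_phi, h]

lemma phi_phi (x y z : X) :
    s.phi x (s.phi y z) = s.phi (s.g x y) (s.phi (s.f y x) z) := by
  obtain ⟨t, rfl⟩ : ∃ t, s.f y (s.f x t) = z :=
    ⟨s.phi x (s.phi y z), by rw [f_phi, f_phi]⟩
  have h : s.f y (s.f x t) = s.f (s.f y x) (s.f (s.g x y) t) :=
    congrArg (fun p => p.2.2) (congrFun s.braided (t, x, y))
  rw [phi_f, phi_f, h, phi_f, phi_f]

lemma f_f_g (x y : X) : s.f (s.f y x) (s.g x y) = y :=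
  congrArg Prod.snd (s.involutive (x, y))

open Classical in
lemma psi_psi_single (x y z : X) :
    s.psiLin x (s.psiLin y (Finsupp.single z 1)) =
      ((if z = y then -1 else 1 : ℝ) * (if z = s.f y x then -1 else 1 : ℝ)) •
        Finsupp.single (s.phi x (s.phi y z)) 1 := by
  have h : s.phi y z = x ↔ z = s.f y x :=
    ⟨fun h => by rw [← h, f_phi], fun h => by rw [h, phi_f]⟩
  rw [psiLin_single]
  by_cases h1 : z = y
  · rw [if_pos h1, if_pos h1, map_neg, psiLin_single]
    by_cases h2 : z = s.f y x
    · rw [if_pos h2, if_pos (h.mpr h2)]; simp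
    · rw [if_neg h2, if_neg (mt h.mp h2)]; simp
  · rw [if_neg h1, if_neg h1, psiLin_single]
    by_cases h2 : z = s.f y x
    · rw [if_pos h2, if_pos (h.mpr h2)]; simp
    · rw [if_neg h2, if_neg (mt h.mp h2)]; simp

/-- The maps `ψ_x` satisfy the defining relations of the structure group. -/
lemma psiGen_mul (x y : X) :
    s.psiGen x * s.psiGen y = s.psiGen (s.g x y) * s.psiGen (s.f y x) := by
  apply Units.ext
  show s.psiLin x * s.psiLin y = s.psiLin (s.g x y) * s.psiLin (s.f y x)
  ext1 z
  ext1
  simp only [LinearMap.comp_apply, Finsupp.lsingle_apply, Module.End.mul_apply,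
    psi_psi_single]
  rw [f_f_g, ← phi_phi, mul_comm]

/-- The representation `ψ : G(X, S) → GL(V)`. -/
def psi : s.StructureGroup →* LinearMap.GeneralLinearGroup ℝ (X →₀ ℝ) :=
  PresentedGroup.toGroup (f := s.psiGen) (by
    rintro r ⟨x, y, -, rfl⟩
    simp only [map_mul, map_inv, FreeGroup.lift_apply_of]
    rw [s.psiGen_mul x y, mul_inv_cancel])

/-- The group `W(X, S) = ψ(G(X, S))`. -/
abbrev W : Subgroup (LinearMap.GeneralLinearGroup ℝ (X →₀ ℝ)) := s.psi.range

/-- The surjective morphism `ψ : M(X, S) → W(X, S)`, the composite of `M(X, S) → G(X, S)` and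
`ψ : G(X, S) → W(X, S)`. -/
def psiW : s.StructureMonoid →* s.W := s.psi.rangeRestrict.comp s.toGroup

/-- The generating set `{ψ_x | x ∈ X}` of `W(X, S)`. -/
def gens : Set s.W := Set.range fun x => s.psiW (PresentedMonoid.of s.monoidRel x)

end SymmSolution

/-- A Garside element of a monoid: it is balanced (its left and its right divisors are the same
elements), and its divisors generate the monoid. Here `a ∣ d` is left divisibility, `d = a * c` for
some `c`, and `RightDvd a d` is right divisibility, `d = c * a` for some `c`. -/
def IsGarsideElement {M : Type*} [Monoid M] (d : M) : Prop :=
  (∀ a, a ∣ d ↔ RightDvd a d) ∧ Submonoid.closure {a : M | a ∣ d} = ⊤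

/-- *The* Garside element: the least Garside element, for left and for right divisibility. -/
def IsTheGarsideElement {M : Type*} [Monoid M] (d : M) : Prop :=
  IsGarsideElement d ∧ ∀ e, IsGarsideElement e → d ∣ e ∧ RightDvd d e

/-- The length of `w` with respect to `A`: the least length of a word in the elements of `A` that
represents `w` (it is `⊤` if there is no such word). -/
def wordLength {H : Type*} [Monoid H] (A : Set H) (w : H) : ℕ∞ :=
  ⨅ l : {l : List H // (∀ a ∈ l, a ∈ A) ∧ l.prod = w}, (l.1.length : ℕ∞)

end

/-!
The generators act on `X` through the permutations `φ_x`, and the map that counts generators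
extends along this action to a cocycle `M(X, S) → ℕ^X`. It is bijective: inserting a letter into the
value of the cocycle corresponds to multiplying by one generator on the left, and insertions of two
letters commute by the defining relations, so every multiset is the value at a unique element.
Right divisibility becomes inclusion of multisets, and the Garside element `Δ` corresponds to the
multiset in which every letter occurs once. Since that multiset is invariant under permutations,
conjugation by `Δ` permutes the generators, which makes `Δ` balanced.

`ψ(a)` is the signed permutation matrix whose signs are given by the cocycle modulo two. Property
(C) says that a double letter of the cocycle can be deleted without changing `ψ(a)`. Hence `W(X, S)`
is in bijection with the subsets of `X`, and the length of an element is the size of its subset.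
-/

lemma dvd_iff_rightDvd_of_exists_mul_eq_mul {M : Type*} [Monoid M] [IsCancelMul M] {d : M}
    (hleft : ∀ a, ∃ b, d * a = b * d) (hright : ∀ b, ∃ a, d * a = b * d) (a : M) :
    a ∣ d ↔ RightDvd a d := by
  constructor
  · rintro ⟨c, hc⟩
    obtain ⟨b, hb⟩ := hleft c
    refine ⟨b, mul_right_cancel (b := c) ?_⟩
    calc d * c = b * d := hb
      _ = b * a * c := by rw [mul_assoc, ← hc]
  · rintro ⟨c, hc⟩
    obtain ⟨b, hb⟩ := hright c
    refine ⟨b, mul_left_cancel (a := c) ?_⟩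
    calc c * d = d * b := hb.symm
      _ = c * (a * b) := by rw [← mul_assoc, ← hc]

/- The library's `irreducible_subset_of_submonoidClosure_eq_top` assumes commutativity. -/
lemma mem_of_irreducible_of_closure_eq_top {M : Type*} [Monoid M] [Subsingleton Mˣ] {D : Set M}
    (hD : Submonoid.closure D = ⊤) {p : M} (hp : Irreducible p) : p ∈ D := by
  have hmem : p ∈ Submonoid.closure D := hD ▸ Submonoid.mem_top p
  induction hmem using Submonoid.closure_induction with
  | mem p h => exact h
  | one => exact absurd isUnit_one hp.not_isUnit
  | mul a b _ _ iha ihb =>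
    rcases hp.isUnit_or_isUnit rfl with h | h
    · rw [isUnit_iff_eq_one.mp h, one_mul] at hp ⊢
      exact ihb hp
    · rw [isUnit_iff_eq_one.mp h, mul_one] at hp ⊢
      exact iha hp

lemma wordLength_prod_le {H : Type*} [Monoid H] {A : Set H} {l : List H} (hl : ∀ a ∈ l, a ∈ A) :
    wordLength A l.prod ≤ l.length :=
  iInf_le_of_le ⟨l, hl, rfl⟩ le_rfl

noncomputable section

namespace SymmSolution

variable {X : Type*} (s : SymmSolution X)

/-- The generator of `M(X, S)` given by `x`. -/
abbrev gen (x : X) : s.StructureMonoid := PresentedMonoid.of s.monoidRel x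

/-- The action of `M(X, S)` on `X` in which `x` acts as `φ_x`. -/
def perm : s.StructureMonoid →* Equiv.Perm X :=
  PresentedMonoid.lift s.phi (by
    rintro _ _ ⟨x, y, -, rfl, rfl⟩
    exact Equiv.ext fun z => s.phi_phi x y z)

lemma f_comp_f (x y : X) : s.f y ∘ s.f x = s.f (s.f y x) ∘ s.f (s.g x y) :=
  funext fun t => congrArg (fun p => p.2.2) (congrFun s.braided (t, x, y))

/-- The affine right action of `M(X, S)` on `ℕ^X`, in which `x` acts as `m ↦ e_x + f_x(m)`. -/
def affineAction : s.StructureMonoid →* (Function.End (Multiset X))ᵐᵒᵖ :=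
  PresentedMonoid.lift
    (fun x => MulOpposite.op (α := Function.End (Multiset X)) fun m => x ::ₘ m.map (s.f x)) (by
    rintro _ _ ⟨x, y, -, rfl, rfl⟩
    refine MulOpposite.unop_injective (funext fun m => ?_)
    change y ::ₘ (x ::ₘ m.map (s.f x)).map (s.f y) =
      s.f y x ::ₘ (s.g x y ::ₘ m.map (s.f (s.g x y))).map (s.f (s.f y x))
    rw [Multiset.map_cons, Multiset.map_cons, Multiset.map_map, Multiset.map_map, f_comp_f,
      f_f_g, Multiset.cons_swap])

variable {s}

/-- The cocycle `M(X, S) → ℕ^X` extending `x ↦ e_x`, where `ℕ^X` is encoded by multisets: the orbit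
map of the origin under the affine action. -/
def cocycle (a : s.StructureMonoid) : Multiset X := (s.affineAction a).unop 0

/-- The element of `M(X, S)` whose cocycle is that of `a` with the letter `z` inserted. -/
def cons (z : X) (a : s.StructureMonoid) : s.StructureMonoid := s.gen (s.perm a z) * a

lemma gen_mul_eq_cons (x : X) (a : s.StructureMonoid) :
    s.gen x * a = cons ((s.perm a).symm x) a := by
  rw [cons, Equiv.apply_symm_apply]

lemma gen_eq_cons (x : X) : s.gen x = cons x 1 := by
  rw [cons, map_one, Equiv.Perm.one_apply, mul_one]

lemma perm_cons (z : X) (a : s.StructureMonoid) :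
    s.perm (cons z a) = s.phi (s.perm a z) * s.perm a := by
  rw [cons, map_mul]
  rfl

@[elab_as_elim]
lemma cons_induction {P : s.StructureMonoid → Prop} (one : P 1) (cons : ∀ z a, P a → P (cons z a))
    (a : s.StructureMonoid) : P a := by
  have ha : a ∈ Submonoid.closure (Set.range (PresentedMonoid.of s.monoidRel)) := by
    rw [PresentedMonoid.closure_range_of]
    exact Submonoid.mem_top a
  induction ha using Submonoid.closure_induction_left with
  | one => exact one
  | mul_left x hx b _ ih =>
    obtain ⟨x, rfl⟩ := hx
    rw [gen_mul_eq_cons]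
    exact cons _ b ih

lemma affineAction_mul_apply (a b : s.StructureMonoid) (m : Multiset X) :
    (s.affineAction (a * b)).unop m =
      (s.affineAction b).unop ((s.affineAction a).unop m) := by
  rw [map_mul]
  rfl

lemma affineAction_apply (a : s.StructureMonoid) (m : Multiset X) :
    (s.affineAction a).unop m = cocycle a + m.map (s.perm a).symm := by
  induction a using cons_induction generalizing m with
  | one =>
    rw [cocycle, map_one, map_one]
    exact ((zero_add _).trans (Multiset.map_id m)).symm
  | cons z a ih =>
    have hgen (x : X) (m : Multiset X) :
        (s.affineAction (s.gen x)).unop m = x ::ₘ m.map (s.f x) := rfl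
    have hsymm : ⇑(s.perm (cons z a)).symm = (s.perm a).symm ∘ s.f (s.perm a z) := by
      rw [perm_cons]
      rfl
    rw [cocycle, hsymm, cons, affineAction_mul_apply, affineAction_mul_apply, hgen, hgen, ih,
      ih (_ ::ₘ _)]
    simp only [Multiset.map_cons, Multiset.map_zero, Multiset.map_map, Multiset.cons_add,
      Multiset.add_cons, add_zero]

@[simp] lemma cocycle_one : cocycle (1 : s.StructureMonoid) = 0 := by
  rw [cocycle, map_one]
  rfl

lemma cocycle_mul (a b : s.StructureMonoid) :
    cocycle (a * b) = cocycle b + (cocycle a).map (s.perm b).symm := by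
  rw [cocycle, affineAction_mul_apply, affineAction_apply b]
  rfl

@[simp] lemma cocycle_gen (x : X) : cocycle (s.gen x) = {x} := rfl

@[simp] lemma cocycle_cons (z : X) (a : s.StructureMonoid) :
    cocycle (cons z a) = z ::ₘ cocycle a := by
  rw [cons, cocycle_mul, cocycle_gen, Multiset.map_singleton, Equiv.symm_apply_apply, add_comm,
    Multiset.singleton_add]

lemma g_phi (y z : X) : s.g (s.phi z y) z = s.phi y z := by
  have h := s.f_f_g (s.phi z y) z
  rw [f_phi] at h
  rw [← h, phi_f, h]

lemma gen_phi_mul_gen (y z : X) :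
    s.gen (s.phi z y) * s.gen z = s.gen (s.phi y z) * s.gen y := by
  by_cases h : s.IsFrozen (s.phi z y) z
  · have hzy : y = z := (s.f_phi z y).symm.trans (congrArg Prod.snd h)
    rw [hzy]
  · refine PresentedMonoid.mk_eq_mk_of_rel ⟨_, _, h, rfl, ?_⟩
    rw [g_phi, f_phi]

lemma cons_cons_comm (z w : X) (a : s.StructureMonoid) :
    cons z (cons w a) = cons w (cons z a) := by
  rw [cons, perm_cons, cons, cons, perm_cons, cons, ← mul_assoc, ← mul_assoc,
    Equiv.Perm.mul_apply, Equiv.Perm.mul_apply, gen_phi_mul_gen]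

instance : LeftCommutative (cons : X → s.StructureMonoid → s.StructureMonoid) :=
  ⟨cons_cons_comm⟩

variable (s) in
/-- The bijection `M(X, S) ≃ ℕ^X` given by the cocycle; its inverse inserts the letters of a
multiset one by one, in any order. -/
def cocycleEquiv : s.StructureMonoid ≃ Multiset X where
  toFun := cocycle
  invFun := Multiset.foldr cons 1
  left_inv a := by
    induction a using cons_induction with
    | one => rw [cocycle_one, Multiset.foldr_zero]
    | cons z a ih => rw [cocycle_cons, Multiset.foldr_cons, ih]
  right_inv m := by
    induction m using Multiset.induction with
    | empty => rw [Multiset.foldr_zero, cocycle_one]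
    | cons z m ih => rw [Multiset.foldr_cons, cocycle_cons, ih]

lemma cocycle_injective : Function.Injective (cocycle : s.StructureMonoid → Multiset X) :=
  s.cocycleEquiv.injective

lemma cocycle_surjective : Function.Surjective (cocycle : s.StructureMonoid → Multiset X) :=
  s.cocycleEquiv.surjective

lemma exists_eq_cons_of_mem_cocycle {z : X} {a : s.StructureMonoid} (h : z ∈ cocycle a) :
    ∃ b, a = cons z b := by
  obtain ⟨m, hm⟩ := Multiset.exists_cons_of_mem h
  obtain ⟨b, rfl⟩ := cocycle_surjective (s := s) m
  exact ⟨b, cocycle_injective (by rw [hm, cocycle_cons])⟩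

lemma rightDvd_iff_cocycle_le {a b : s.StructureMonoid} :
    RightDvd a b ↔ cocycle a ≤ cocycle b := by
  constructor
  · rintro ⟨c, rfl⟩
    rw [cocycle_mul]
    exact Multiset.le_add_right _ _
  · intro h
    obtain ⟨m, hm⟩ := Multiset.le_iff_exists_add.mp h
    obtain ⟨c, hc⟩ := cocycle_surjective (s := s) (m.map (s.perm a))
    refine ⟨c, cocycle_injective ?_⟩
    rw [cocycle_mul, hc, Multiset.map_map, Equiv.symm_comp_self, Multiset.map_id, hm]

instance : IsCancelMul s.StructureMonoid where
  mul_left_cancel a b c h := by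
    have hperm : s.perm b = s.perm c := by
      simpa only [map_mul, mul_right_inj] using congrArg s.perm h
    have hcocycle := congrArg cocycle h
    simp only [cocycle_mul, hperm, add_left_inj] at hcocycle
    exact cocycle_injective hcocycle
  mul_right_cancel a b c h := by
    have hcocycle := congrArg cocycle h
    simp only [cocycle_mul, add_right_inj] at hcocycle
    exact cocycle_injective (Multiset.map_injective (Equiv.injective _) hcocycle)

lemma card_cocycle_mul (a b : s.StructureMonoid) :
    (cocycle (a * b)).card = (cocycle a).card + (cocycle b).card := by
  rw [cocycle_mul, Multiset.card_add, Multiset.card_map, add_comm]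

lemma card_cocycle_eq_zero {a : s.StructureMonoid} : (cocycle a).card = 0 ↔ a = 1 := by
  rw [Multiset.card_eq_zero, ← cocycle_one (s := s), cocycle_injective.eq_iff]

instance : Subsingleton (s.StructureMonoid)ˣ :=
  Subsingleton.units_of_isUnit fun a ha => by
    obtain ⟨b, hab⟩ := ha.exists_right_inv
    have hcard := card_cocycle_mul a b
    rw [hab, cocycle_one, Multiset.card_zero] at hcard
    exact card_cocycle_eq_zero.mp (by omega)

lemma irreducible_gen (x : X) : Irreducible (s.gen x) where
  not_isUnit h := by
    have hcard := card_cocycle_eq_zero.mpr (isUnit_iff_eq_one.mp h)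
    rw [cocycle_gen, Multiset.card_singleton] at hcard
    exact one_ne_zero hcard
  isUnit_or_isUnit a b h := by
    have hcard := card_cocycle_mul a b
    rw [← h, cocycle_gen, Multiset.card_singleton] at hcard
    rw [isUnit_iff_eq_one, isUnit_iff_eq_one, ← card_cocycle_eq_zero, ← card_cocycle_eq_zero]
    omega

lemma gen_rightDvd_of_isGarsideElement {e : s.StructureMonoid} (he : IsGarsideElement e) (x : X) :
    RightDvd (s.gen x) e :=
  (he.1 _).mp (mem_of_irreducible_of_closure_eq_top he.2 (irreducible_gen x))

lemma eq_of_isTheGarsideElement {d e : s.StructureMonoid} (hd : IsTheGarsideElement d)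
    (he : IsTheGarsideElement e) : d = e :=
  cocycle_injective (le_antisymm (rightDvd_iff_cocycle_le.mp (hd.2 e he.1).2)
    (rightDvd_iff_cocycle_le.mp (he.2 d hd.1).2))

section Garside

variable [Fintype X]

variable (s) in
/-- The element `Δ` of `M(X, S)` in whose cocycle every letter occurs exactly once. -/
def garside : s.StructureMonoid := s.cocycleEquiv.symm Finset.univ.val

lemma cocycle_garside : cocycle s.garside = Finset.univ.val :=
  s.cocycleEquiv.apply_symm_apply _

lemma garside_mul_gen (x : X) :
    s.garside * s.gen x = s.gen (s.perm s.garside x) * s.garside := by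
  refine cocycle_injective ?_
  rw [← cons, cocycle_cons, cocycle_mul, cocycle_gen, cocycle_garside,
    Multiset.map_univ_val_equiv, Multiset.singleton_add]

lemma exists_garside_mul_eq_mul_garside (a : s.StructureMonoid) :
    ∃ b, s.garside * a = b * s.garside := by
  induction a using cons_induction with
  | one => exact ⟨1, by rw [mul_one, one_mul]⟩
  | cons z a ih =>
    obtain ⟨b, hb⟩ := ih
    refine ⟨s.gen (s.perm s.garside (s.perm a z)) * b, ?_⟩
    rw [cons, ← mul_assoc, garside_mul_gen, mul_assoc, hb, mul_assoc]

lemma exists_mul_garside_eq_garside_mul (b : s.StructureMonoid) :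
    ∃ a, s.garside * a = b * s.garside := by
  induction b using cons_induction with
  | one => exact ⟨1, by rw [mul_one, one_mul]⟩
  | cons z b ih =>
    obtain ⟨a, ha⟩ := ih
    refine ⟨s.gen ((s.perm s.garside).symm (s.perm b z)) * a, ?_⟩
    rw [cons, ← mul_assoc, garside_mul_gen, Equiv.apply_symm_apply, mul_assoc, ha, mul_assoc]

lemma isGarsideElement_garside : IsGarsideElement s.garside := by
  have hbalanced := dvd_iff_rightDvd_of_exists_mul_eq_mul
    (exists_garside_mul_eq_mul_garside (s := s)) exists_mul_garside_eq_garside_mul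
  refine ⟨hbalanced, ?_⟩
  rw [eq_top_iff, ← PresentedMonoid.closure_range_of]
  refine Submonoid.closure_mono (Set.range_subset_iff.mpr fun x => ?_)
  refine (hbalanced _).mpr (rightDvd_iff_cocycle_le.mpr ?_)
  rw [cocycle_gen, cocycle_garside, Multiset.singleton_le]
  exact Finset.mem_univ x

lemma isTheGarsideElement_garside : IsTheGarsideElement s.garside := by
  refine ⟨isGarsideElement_garside, fun e he => ?_⟩
  have hright : RightDvd s.garside e := by
    rw [rightDvd_iff_cocycle_le, cocycle_garside, Multiset.le_iff_subset Finset.univ.nodup]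
    intro x _
    have hx := rightDvd_iff_cocycle_le.mp (gen_rightDvd_of_isGarsideElement he x)
    rwa [cocycle_gen, Multiset.singleton_le] at hx
  exact ⟨(he.1 _).mpr hright, hright⟩

end Garside

section Representation

lemma coe_psiW_gen (x : X) :
    (s.psiW (s.gen x) : LinearMap.GeneralLinearGroup ℝ (X →₀ ℝ)) = s.psiGen x :=
  PresentedGroup.toGroup.of _

lemma psiGen_single [DecidableEq X] (x y : X) (c : ℝ) :
    (s.psiGen x).val (Finsupp.single y c) =
      Finsupp.single (s.phi x y) (if y = x then -c else c) := by
  change s.psiLin x (Finsupp.single y c) = _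
  rw [← Finsupp.smul_single_one, map_smul, psiLin_single]
  split_ifs <;> simp

lemma psiW_single [DecidableEq X] (a : s.StructureMonoid) (y : X) :
    (s.psiW a : LinearMap.GeneralLinearGroup ℝ (X →₀ ℝ)).val (Finsupp.single y 1) =
      Finsupp.single (s.perm a y) ((-1) ^ (cocycle a).count y) := by
  induction a using cons_induction with
  | one => simp
  | cons z a ih =>
    rw [cocycle_cons, perm_cons, Equiv.Perm.mul_apply, cons, map_mul, Subgroup.coe_mul,
      coe_psiW_gen, Units.val_mul, Module.End.mul_apply, ih, psiGen_single, Multiset.count_cons]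
    simp only [(s.perm a).injective.eq_iff]
    split_ifs <;> simp [pow_succ]

/-- The set of letters with an odd multiplicity in the cocycle: the places of the signs in the
signed permutation `ψ(a)`. -/
def oddSupport [DecidableEq X] (a : s.StructureMonoid) : Set X := {y | Odd ((cocycle a).count y)}

lemma psiW_eq_iff_perm_eq_and_oddSupport_eq [DecidableEq X] {a b : s.StructureMonoid} :
    s.psiW a = s.psiW b ↔ s.perm a = s.perm b ∧ oddSupport a = oddSupport b := by
  have hsign (m n : ℕ) : (-1 : ℝ) ^ m = (-1) ^ n ↔ (Odd m ↔ Odd n) := by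
    rcases m.even_or_odd with hm | hm <;> rcases n.even_or_odd with hn | hn <;>
      simp [hm.neg_one_pow, hn.neg_one_pow, hm, hn, ← Nat.not_even_iff_odd] <;> norm_num
  have hbasis : s.psiW a = s.psiW b ↔ ∀ y,
      (s.psiW a : LinearMap.GeneralLinearGroup ℝ (X →₀ ℝ)).val (Finsupp.single y 1) =
        (s.psiW b : LinearMap.GeneralLinearGroup ℝ (X →₀ ℝ)).val (Finsupp.single y 1) :=
    ⟨fun h _ => by rw [h], fun h => Subtype.ext (Units.ext (Finsupp.lhom_ext' fun y =>
      LinearMap.ext_ring (h y)))⟩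
  simp [hbasis, psiW_single, Finsupp.single_eq_single_iff, hsign, forall_and, Equiv.ext_iff,
    Set.ext_iff, oddSupport]

lemma isFrozen_phi_self (z : X) : s.IsFrozen (s.phi z z) z :=
  Prod.ext (g_phi z z) (s.f_phi z z)

lemma PropertyC.phi_phi_self_mul_phi (hC : s.PropertyC) (z : X) :
    s.phi (s.phi z z) * s.phi z = 1 := by
  refine Equiv.ext fun y => ?_
  have hf := congrFun (hC _ _ (isFrozen_phi_self z)).2 (s.phi (s.phi z z) (s.phi z y))
  rw [Function.comp_apply, f_phi, f_phi] at hf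
  exact hf.symm

lemma PropertyC.psiW_cons_cons_self (hC : s.PropertyC) (z : X) (a : s.StructureMonoid) :
    s.psiW (cons z (cons z a)) = s.psiW a := by
  classical
  refine psiW_eq_iff_perm_eq_and_oddSupport_eq.mpr ⟨?_, Set.ext fun y => ?_⟩
  · rw [perm_cons, perm_cons, Equiv.Perm.mul_apply, ← mul_assoc, hC.phi_phi_self_mul_phi, one_mul]
  · by_cases hy : y = z <;> simp [oddSupport, Multiset.count_cons, hy, Nat.odd_add_one]

lemma psiW_cons_congr {a b : s.StructureMonoid} (h : s.psiW a = s.psiW b) (z : X) :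
    s.psiW (cons z a) = s.psiW (cons z b) := by
  classical
  rw [cons, cons, (psiW_eq_iff_perm_eq_and_oddSupport_eq.mp h).1, map_mul, map_mul, h]

lemma PropertyC.psiW_surjective (hC : s.PropertyC) : Function.Surjective s.psiW := by
  refine s.psi.rangeRestrict_surjective.forall.mpr fun t => ?_
  have ht : t ∈ Subgroup.closure (Set.range (PresentedGroup.of (rels := s.groupRels))) := by
    rw [PresentedGroup.closure_range_of]
    exact Subgroup.mem_top t
  induction ht using Subgroup.closure_induction_left with
  | one => exact ⟨1, by rw [map_one, map_one]⟩
  | mul_left x hx t _ ih =>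
    obtain ⟨x, rfl⟩ := hx
    obtain ⟨a, ha⟩ := ih
    exact ⟨s.gen x * a, by rw [map_mul, map_mul, ha]; rfl⟩
  | inv_mul_cancel x hx t _ ih =>
    obtain ⟨x, rfl⟩ := hx
    obtain ⟨a, ha⟩ := ih
    have hinv : s.psiW (s.gen (s.perm (s.gen x) x)) * s.psiW (s.gen x) = 1 := by
      rw [← map_mul, ← cons, gen_eq_cons, hC.psiW_cons_cons_self, map_one]
    refine ⟨s.gen (s.perm (s.gen x) x) * a, ?_⟩
    rw [map_mul, eq_inv_of_mul_eq_one_left hinv, ha, map_mul, map_inv]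
    rfl

lemma PropertyC.exists_nodup_cocycle (hC : s.PropertyC) (a : s.StructureMonoid) :
    ∃ r : s.StructureMonoid, (cocycle r).Nodup ∧ s.psiW r = s.psiW a := by
  induction a using cons_induction with
  | one => exact ⟨1, by rw [cocycle_one]; exact Multiset.nodup_zero, rfl⟩
  | cons z a ih =>
    obtain ⟨r, hr, hra⟩ := ih
    by_cases hz : z ∈ cocycle r
    · obtain ⟨b, rfl⟩ := exists_eq_cons_of_mem_cocycle hz
      rw [cocycle_cons, Multiset.nodup_cons] at hr
      refine ⟨b, hr.2, ?_⟩
      rw [← psiW_cons_congr hra, hC.psiW_cons_cons_self]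
    · refine ⟨cons z r, ?_, psiW_cons_congr hra z⟩
      rw [cocycle_cons, Multiset.nodup_cons]
      exact ⟨hz, hr⟩

lemma exists_prod_map_gen_eq (a : s.StructureMonoid) : ∃ l : List X, (l.map s.gen).prod = a := by
  induction a using cons_induction with
  | one => exact ⟨[], rfl⟩
  | cons z a ih =>
    obtain ⟨l, rfl⟩ := ih
    exact ⟨s.perm (l.map s.gen).prod z :: l, by rw [List.map_cons, List.prod_cons, cons]⟩

lemma card_cocycle_prod_map_gen (l : List X) :
    (cocycle (l.map s.gen).prod).card = l.length := by
  induction l with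
  | nil => rw [List.map_nil, List.prod_nil, cocycle_one, Multiset.card_zero, List.length_nil]
  | cons x l ih =>
    rw [List.map_cons, List.prod_cons, card_cocycle_mul, ih, cocycle_gen, Multiset.card_singleton,
      List.length_cons, add_comm]

section Length

variable [DecidableEq X]

lemma oddSupport_eq_toFinset_of_nodup {a : s.StructureMonoid} (ha : (cocycle a).Nodup) :
    oddSupport a = (cocycle a).toFinset := by
  ext y
  rw [oddSupport, Set.mem_ofPred_eq, Multiset.count_eq_of_nodup ha]
  split_ifs with hy <;> simp [hy]

lemma encard_oddSupport_le (a : s.StructureMonoid) :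
    (oddSupport a).encard ≤ (cocycle a).card := by
  have hsub : oddSupport a ⊆ (cocycle a).toFinset := fun y hy =>
    Multiset.mem_toFinset.mpr (Multiset.count_pos.mp hy.pos)
  calc (oddSupport a).encard ≤ ((cocycle a).toFinset : Set X).encard := Set.encard_le_encard hsub
    _ = (cocycle a).toFinset.card := Set.encard_coe_eq_coe_finsetCard _
    _ ≤ (cocycle a).card := by exact_mod_cast Multiset.toFinset_card_le _

lemma encard_oddSupport_of_nodup {a : s.StructureMonoid} (ha : (cocycle a).Nodup) :
    (oddSupport a).encard = (cocycle a).card := by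
  rw [oddSupport_eq_toFinset_of_nodup ha, Set.encard_coe_eq_coe_finsetCard,
    Multiset.toFinset_card_of_nodup ha]

lemma PropertyC.psiW_eq_iff_oddSupport_eq (hC : s.PropertyC) {a b : s.StructureMonoid} :
    s.psiW a = s.psiW b ↔ oddSupport a = oddSupport b := by
  refine ⟨fun h => (psiW_eq_iff_perm_eq_and_oddSupport_eq.mp h).2, fun h => ?_⟩
  obtain ⟨p, hp, hpa⟩ := hC.exists_nodup_cocycle a
  obtain ⟨q, hq, hqb⟩ := hC.exists_nodup_cocycle b
  have hpq : oddSupport p = oddSupport q := by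
    rw [(psiW_eq_iff_perm_eq_and_oddSupport_eq.mp hpa).2, h,
      (psiW_eq_iff_perm_eq_and_oddSupport_eq.mp hqb).2]
  rw [oddSupport_eq_toFinset_of_nodup hp, oddSupport_eq_toFinset_of_nodup hq, Finset.coe_inj] at hpq
  rw [← hpa, ← hqb, cocycle_injective (Multiset.Nodup.toFinset_inj hp hq hpq)]

lemma PropertyC.wordLength_psiW (hC : s.PropertyC) (a : s.StructureMonoid) :
    wordLength s.gens (s.psiW a) = (oddSupport a).encard := by
  refine le_antisymm ?_ (le_iInf ?_)
  · obtain ⟨r, hr, hra⟩ := hC.exists_nodup_cocycle a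
    obtain ⟨l, rfl⟩ := exists_prod_map_gen_eq r
    have hl : ∀ v ∈ l.map (s.psiW ∘ s.gen), v ∈ s.gens := by
      simp [gens]
    have hprod : (l.map (s.psiW ∘ s.gen)).prod = s.psiW a := by
      rw [← hra, map_list_prod, List.map_map]
    rw [← hC.psiW_eq_iff_oddSupport_eq.mp hra, encard_oddSupport_of_nodup hr,
      card_cocycle_prod_map_gen, ← hprod]
    simpa using wordLength_prod_le hl
  · rintro ⟨l, hl, hprod⟩
    obtain ⟨l, rfl⟩ : l ∈ Set.range (List.map (s.psiW ∘ s.gen)) := by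
      rw [Set.range_list_map]
      exact hl
    rw [← List.map_map, ← map_list_prod] at hprod
    rw [← hC.psiW_eq_iff_oddSupport_eq.mp hprod, List.length_map, ← card_cocycle_prod_map_gen]
    exact encard_oddSupport_le _

end Length

section LongestElement

variable [Fintype X]

lemma oddSupport_garside [DecidableEq X] : oddSupport s.garside = Set.univ := by
  ext y
  simp [oddSupport, cocycle_garside]

lemma PropertyC.wordLength_psiW_garside (hC : s.PropertyC) :
    wordLength s.gens (s.psiW s.garside) = Nat.card X := by
  classical
  rw [hC.wordLength_psiW, oddSupport_garside, Set.encard_univ, ENat.card_eq_coe_natCard]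

lemma PropertyC.forall_wordLength_le_iff (hC : s.PropertyC) (w : s.W) :
    (∀ v, wordLength s.gens v ≤ wordLength s.gens w) ↔ w = s.psiW s.garside := by
  classical
  obtain ⟨a, rfl⟩ := hC.psiW_surjective w
  simp only [hC.psiW_surjective.forall, hC.psiW_eq_iff_oddSupport_eq, hC.wordLength_psiW]
  constructor
  · intro h
    refine Set.Finite.eq_of_subset_of_encard_le (Set.toFinite _) ?_ (h s.garside)
    rw [oddSupport_garside]
    exact Set.subset_univ _
  · intro h b
    rw [h, oddSupport_garside]
    exact Set.encard_le_encard (Set.subset_univ _)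

lemma PropertyC.orderOf_psiW_garside [Nonempty X] (hC : s.PropertyC) :
    orderOf (s.psiW s.garside) = 2 := by
  classical
  have hone : oddSupport (1 : s.StructureMonoid) = ∅ := by simp [oddSupport]
  refine orderOf_eq_prime ?_ ?_
  · rw [← map_pow, ← map_one s.psiW, hC.psiW_eq_iff_oddSupport_eq, hone]
    ext y
    simp [oddSupport, sq, cocycle_mul, cocycle_garside, Multiset.map_univ_val_equiv]
  · rw [← map_one s.psiW, Ne, hC.psiW_eq_iff_oddSupport_eq, oddSupport_garside, hone]
    exact Set.univ_nonempty.ne_empty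

lemma bijOn_conj_psiW_garside :
    Set.BijOn (fun v => s.psiW s.garside * v * (s.psiW s.garside)⁻¹) s.gens s.gens := by
  have hconj (x : X) : s.psiW s.garside * s.psiW (s.gen x) * (s.psiW s.garside)⁻¹ =
      s.psiW (s.gen (s.perm s.garside x)) := by
    rw [mul_inv_eq_iff_eq_mul, ← map_mul, ← map_mul, garside_mul_gen]
  have himage : MulAut.conj (s.psiW s.garside) '' s.gens = s.gens := by
    rw [gens, ← Set.range_comp]
    calc _ = Set.range ((s.psiW ∘ s.gen) ∘ s.perm s.garside) := congrArg Set.range (funext hconj)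
      _ = Set.range (s.psiW ∘ s.gen) := (s.perm s.garside).surjective.range_comp _
  have hbij := (MulAut.conj (s.psiW s.garside)).injective.injOn.bijOn_image (s := s.gens)
  rwa [himage] at hbij

end LongestElement

end Representation

end SymmSolution

end

theorem mainTheorem10 {X : Type*} [Finite X] [Nonempty X] (s : SymmSolution X)
    (hC : s.PropertyC) :
    ∃ Δ : s.StructureMonoid,
      IsTheGarsideElement Δ ∧
      (∀ d : s.StructureMonoid, IsTheGarsideElement d → d = Δ) ∧
      (∀ w : s.W, (∀ v : s.W, wordLength s.gens v ≤ wordLength s.gens w) ↔ w = s.psiW Δ) ∧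
      wordLength s.gens (s.psiW Δ) = (Nat.card X : ℕ∞) ∧
      orderOf (s.psiW Δ) = 2 ∧
      Set.BijOn (fun a : s.W => s.psiW Δ * a * (s.psiW Δ)⁻¹) s.gens s.gens := by
  cases nonempty_fintype X
  have hΔ : IsTheGarsideElement s.garside := SymmSolution.isTheGarsideElement_garside
  exact ⟨s.garside, hΔ, fun d hd => SymmSolution.eq_of_isTheGarsideElement hd hΔ,
    hC.forall_wordLength_le_iff, hC.wordLength_psiW_garside, hC.orderOf_psiW_garside,
    SymmSolution.bijOn_conj_psiW_garside⟩
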